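/- Conventions. For a small category $\mathsf A$ let $U\mathsf A$ be its underlying reflexive directed graph, $F$ the free category functor on reflexive directed graphs (left adjoint to $U$), and let $\mathfrak C\mathsf A$ be the *free resolution* of $\mathsf A$: the simplicial category with $\mathrm{ob}\,\mathfrak C\mathsf A=\mathrm{ob}\,\mathsf A$ whose category of $n$-arrows is $(FU)^{n+1}\mathsf A$, with faces and degeneracies given by the comonad resolution of $\mathsf A$ for the comonad $FU$. This is functorial in $\mathsf A$. A *homotopy coherent diagram of shape $\mathsf A$* in a simplicial category $\mathbb S$ is a simplicial functor $\mathfrak C\mathsf A\to\mathbb S$. The *homotopy coherent nerve* $\mathfrak N\mathbb S$ is the simplicial set with $(\mathfrak N\mathbb S)_n=\{\text{simplicial functors }\mathfrak C[n]\to\mathbb S\}$, where $[n]$ is the ordinal category $0\to1\to\dots\to n$, and $\mathrm{Coh}(\mathsf A,\mathbb S)$ is the simplicial set with $\mathrm{Coh}(\mathsf A,\mathbb S)_n=\{\text{simplicial functors }\mathfrak C(\mathsf A\times[n])\to\mathbb S\}$; in both cases the simplicial structure is restriction along the functors $[m]\to[n]$. Write $N\mathsf A$ for the nerve of $\mathsf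 A$. Statement. Let $\mathsf A$ be a small category and let $\mathbb S$ be a (possibly large) category enriched in simplicial sets. 1. There is a bijection $$\{\text{simplicial functors } \mathfrak C\mathsf A\to\mathbb S\}\;\cong\;\{\text{simplicial maps } N\mathsf A\to\mathfrak N\mathbb S\},$$ natural in $\mathsf A$ (with respect to functors) and in $\mathbb S$ (with respect to simplicial functors). It sends $X\colon\mathfrak C\mathsf A\to\mathbb S$ to the simplicial map whose value at an $n$-simplex $x\colon[n]\to\mathsf A$ of $N\mathsf A$ is $X\circ\mathfrak Cx\colon\mathfrak C[n]\to\mathbb S$. 2. The simplicial set $\mathrm{Coh}(\mathsf A,\mathbb S)$ is isomorphic to $(\mathfrak N\mathbb S)^{N\mathsf A}$, the internal hom in simplicial sets. The isomorphism can be chosen so that the map $N\mathsf A\times\mathrm{Coh}(\mathsf A,\mathbb S)\to\mathfrak N\mathbb S$ corresponding to it sends a pair of $n$-simplices $x\colon[n]\to\mathsf A$ and $X\colon\mathfrak C(\mathsf A\times[n])\to\mathbb S$ to $X\circ\mathfrak C(x,\mathrm{id}_{[n]})\colon\mathfrak C[n]\to\mathbb S$. -/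

import Mathlib

open CategoryTheory Opposite MonoidalCategory

universe v u w

namespace HCoh

/-! ### The resolution of an object by a comonad -/

section Resolution

variable {D : Type w} [Category.{v} D]

/-- The iterate `Gⁿ X`. -/
abbrev iter (G : Comonad D) : ℕ → D → D
  | 0, X => X
  | n + 1, X => G.obj (iter G n X)

/-- The restriction of a monotone map to the elements other than the first. -/
def tail {m n : ℕ} (θ : Fin (m + 1) →o Fin n) : Fin m →o Fin n :=
  θ.comp ⟨Fin.succ, Fin.strictMono_succ.monotone⟩

/-- A monotone map that omits the value `0`, with all values lowered by one. -/
def lower {m n : ℕ} (θ : Fin (m + 1) →o Fin (n + 1)) (h : θ 0 ≠ 0) : Fin (m + 1) →o Fin n where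
  toFun i := (θ i).pred fun hi => h (le_antisymm (hi ▸ θ.monotone (Fin.zero_le i)) (Fin.zero_le _))
  monotone' _ _ hij := Fin.pred_le_pred_iff.2 (θ.monotone hij)

/-- The unique map out of the empty linear order. -/
def empty (n : ℕ) : Fin 0 →o Fin n := ⟨Fin.elim0, fun i => i.elim0⟩

instance (n : ℕ) : Subsingleton (Fin 0 →o Fin n) :=
  ⟨fun _ _ => OrderHom.ext _ _ (funext fun i => i.elim0)⟩

/-- The map `Gⁿ X ⟶ Gᵐ X` induced by a monotone map `θ : Fin m → Fin n`. The copies of `G` are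
numbered from the outside (so the outermost one has number `0`); the counit is applied to the
copies whose number is not a value of `θ`, and the comultiplication is applied repeatedly to those
whose number is a repeated value. -/
def act (G : Comonad D) (X : D) :
    ∀ (m n : ℕ), (Fin m →o Fin n) → (iter G n X ⟶ iter G m X)
  | 0, 0, _ => 𝟙 (iter G 0 X)
  | _ + 1, 0, θ => (θ 0).elim0
  | 0, n + 1, _ => G.ε.app (iter G n X) ≫ act G X 0 n (empty n)
  | m + 1, n + 1, θ =>
    if h : θ 0 = 0 then
      G.δ.app (iter G n X) ≫ G.map (act G X m (n + 1) (tail θ))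
    else
      G.ε.app (iter G n X) ≫ act G X (m + 1) n (lower θ h)
termination_by m n => m + n

variable (G : Comonad D)

lemma act_succ_of_eq (X : D) {m n : ℕ} (θ : Fin (m + 1) →o Fin (n + 1)) (h : θ 0 = 0) :
    act G X (m + 1) (n + 1) θ =
      G.δ.app (iter G n X) ≫ G.map (act G X m (n + 1) (tail θ)) := by
  rw [act, dif_pos h]

lemma act_succ_of_ne (X : D) {m n : ℕ} (θ : Fin (m + 1) →o Fin (n + 1)) (h : θ 0 ≠ 0) :
    act G X (m + 1) (n + 1) θ =
      G.ε.app (iter G n X) ≫ act G X (m + 1) n (lower θ h) := by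
  rw [act, dif_neg h]

lemma act_zero_succ (X : D) {n : ℕ} (θ : Fin 0 →o Fin (n + 1)) (θ' : Fin 0 →o Fin n) :
    act G X 0 (n + 1) θ = G.ε.app (iter G n X) ≫ act G X 0 n θ' := by
  rw [act, Subsingleton.elim θ' (empty n)]

lemma act_id (X : D) : ∀ n : ℕ, act G X n n OrderHom.id = 𝟙 (iter G n X)
  | 0 => by rw [act]
  | n + 1 => by
    rw [act_succ_of_eq G X _ rfl]
    have key : act G X n (n + 1) (tail OrderHom.id) = G.ε.app (iter G n X) := by
      cases n with
      | zero =>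
        rw [act_zero_succ G X _ OrderHom.id, act_id X 0]
        exact Category.comp_id _
      | succ n =>
        rw [act_succ_of_ne G X _ (by simp [tail])]
        have : lower (tail OrderHom.id) (by simp [tail]) =
            (OrderHom.id : Fin (n + 1) →o Fin (n + 1)) := by
          ext i; simp [lower, tail]
        rw [this, act_id X (n + 1)]
        exact Category.comp_id _
    rw [key]
    exact G.right_counit _

lemma act_comp (X : D) : ∀ (l m n : ℕ) (θ : Fin m →o Fin n) (ψ : Fin l →o Fin m),
    act G X m n θ ≫ act G X l m ψ = act G X l n (θ.comp ψ)
  | 0, 0, 0, θ, ψ => by rw [Subsingleton.elim θ OrderHom.id, act_id]; exact Category.id_comp _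
  | _ + 1, 0, _, _, ψ => (ψ 0).elim0
  | _, _ + 1, 0, θ, _ => (θ 0).elim0
  | 0, 0, n + 1, θ, ψ => by
    rw [act_zero_succ G X θ (empty n),
      act_zero_succ G X (θ.comp ψ) ((empty n).comp ψ),
      Category.assoc, act_comp X 0 0 n]
  | 0, m + 1, n + 1, θ, ψ => by
    by_cases h : θ 0 = 0
    · rw [act_succ_of_eq G X θ h, act_zero_succ G X ψ (empty m),
        Category.assoc, G.counit_naturality_assoc, act_comp X 0 m (n + 1),
        G.left_counit_assoc]
      congr 1; exact Subsingleton.elim _ _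
    · rw [act_succ_of_ne G X θ h, Category.assoc, act_comp X 0 (m + 1) n,
        ← act_zero_succ G X (θ.comp ψ)]
  | l + 1, m + 1, n + 1, θ, ψ => by
    by_cases h : θ 0 = 0
    · by_cases h' : ψ 0 = 0
      · rw [act_succ_of_eq G X (θ.comp ψ) (by simp [h, h']), act_succ_of_eq G X ψ h']
        have e : tail (θ.comp ψ) = θ.comp (tail ψ) := rfl
        rw [e, ← act_comp X l (m + 1) (n + 1) θ (tail ψ), act_succ_of_eq G X θ h]
        simp only [Category.assoc, Functor.map_comp, G.delta_naturality_assoc]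
        have := G.coassoc (iter G n X)
        rw [reassoc_of% this]
      · rw [act_succ_of_eq G X θ h, act_succ_of_ne G X ψ h', Category.assoc,
          G.counit_naturality_assoc, act_comp X (l + 1) m (n + 1), G.left_counit_assoc]
        congr 1
        ext i
        have hi : ψ i ≠ 0 := fun e =>
          h' (le_antisymm (e ▸ ψ.monotone (Fin.zero_le i)) (Fin.zero_le _))
        exact congrArg (fun j => ((θ j : Fin (n + 1)) : ℕ)) (Fin.succ_pred (ψ i) hi)
    · have h' : θ (ψ 0) ≠ 0 := fun e =>
        h (le_antisymm (e ▸ θ.monotone (Fin.zero_le _)) (Fin.zero_le _))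
      rw [act_succ_of_ne G X θ h, act_succ_of_ne G X (θ.comp ψ) h', Category.assoc,
        act_comp X (l + 1) (m + 1) n]
      rfl
termination_by l m n => l + m + n

/-- The resolution of an object `X` by a comonad `G`: the simplicial object with
`n`-simplices `Gⁿ⁺¹ X`. Its face `d_i` is `Gⁱ ε G^(n-i)`, and its degeneracy `s_i` is
`Gⁱ δ G^(n-i)`. -/
def resolution (X : D) : SimplicialObject D where
  obj k := iter G (k.unop.len + 1) X
  map f := act G X _ _ f.unop.toOrderHom
  map_id _ := act_id G X _
  map_comp _ _ := (act_comp G X _ _ _ _ _).symm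

end Resolution

/-! ### Category structures on a fixed set of objects, and the free category comonad -/

/-- A small category with set of objects `O`. -/
structure CatOn (O : Type u) where
  str : Category.{u} O

namespace CatOn

variable {O O' O'' : Type u}

/-- The set of objects `O`, carrying the category structure `c`. -/
def Ob (_ : CatOn O) : Type u := O

instance (c : CatOn O) : Category.{u} c.Ob := c.str

/-- The set of arrows from `a` to `b`. -/
abbrev Arr (c : CatOn O) (a b : O) : Type u := (show c.Ob from a) ⟶ (show c.Ob from b)

/-- The identity arrow. -/
abbrev one (c : CatOn O) (a : O) : c.Arr a a := 𝟙 (show c.Ob from a)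

/-- The composite of two arrows, in diagrammatic order. -/
abbrev mul (c : CatOn O) {x y z : O} (f : c.Arr x y) (g : c.Arr y z) : c.Arr x z :=
  CategoryStruct.comp (obj := c.Ob) f g

/-- A functor `c ⥤ d` given on objects by the function `φ`. -/
@[ext]
structure Over (φ : O → O') (c : CatOn O) (d : CatOn O') where
  map : ∀ {a b : O}, c.Arr a b → d.Arr (φ a) (φ b)
  map_one : ∀ a : O, map (c.one a) = d.one (φ a)
  map_mul : ∀ {x y z : O} (f : c.Arr x y) (g : c.Arr y z),
    map (c.mul f g) = d.mul (map f) (map g)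

/-- Composition of functors. -/
def Over.comp {φ : O → O'} {ψ : O' → O''} {c : CatOn O} {d : CatOn O'} {e : CatOn O''}
    (F : Over φ c d) (H : Over ψ d e) : Over (fun a => ψ (φ a)) c e where
  map f := H.map (F.map f)
  map_one a := by rw [F.map_one, H.map_one]
  map_mul f g := by rw [F.map_mul, H.map_mul]

/-- The functor `c ⥤ d` underlying an element of `Over φ c d`. -/
def Over.toFunctor {φ : O → O'} {c : CatOn O} {d : CatOn O'} (F : Over φ c d) :
    c.Ob ⥤ d.Ob where
  obj a := φ a
  map f := F.map f
  map_id a := F.map_one a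
  map_comp f g := F.map_mul f g

/-- Categories with set of objects `O` and identity-on-objects functors form a category. -/
instance : Category (CatOn O) where
  Hom c d := Over (fun a => a) c d
  id c := ⟨fun f => f, fun _ => rfl, fun _ _ => rfl⟩
  comp F H := F.comp H

/-- The category `F U c`: the free category (Mathlib's `Cat.FreeRefl`) on the underlying reflexive
directed graph of `c`, regarded as a category with the same set of objects as `c`. -/
def free (c : CatOn O) : CatOn O where
  str :=
    { Hom := fun a b => Cat.FreeRefl.mk (V := c.Ob) a ⟶ Cat.FreeRefl.mk (V := c.Ob) b
      id := fun a => 𝟙 (Cat.FreeRefl.mk (V := c.Ob) a)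
      comp := fun f g => f ≫ g
      id_comp := fun f => Category.id_comp (obj := Cat.FreeRefl c.Ob) f
      comp_id := fun f => Category.comp_id (obj := Cat.FreeRefl c.Ob) f
      assoc := fun f g h => Category.assoc (obj := Cat.FreeRefl c.Ob) f g h }

/-- The generating arrow of `F U c` given by an arrow of `c`. -/
def atom (c : CatOn O) {a b : O} (f : c.Arr a b) : c.free.Arr a b :=
  Cat.FreeRefl.homMk (V := c.Ob) f

lemma atom_one (c : CatOn O) (a : O) : c.atom (c.one a) = c.free.one a :=
  Cat.FreeRefl.homMk_id (V := c.Ob) a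

/-- The functor on `F U c` that extends a map of reflexive directed graphs defined on `c`. -/
def lift {φ : O → O'} {c : CatOn O} {d : CatOn O'}
    (m : ∀ {a b : O}, c.Arr a b → d.Arr (φ a) (φ b))
    (hm : ∀ a : O, m (c.one a) = d.one (φ a)) : Over φ c.free d where
  map f := (Cat.FreeRefl.lift' (V := c.Ob) (D := d.Ob) φ m hm).map f
  map_one a := (Cat.FreeRefl.lift' (V := c.Ob) (D := d.Ob) φ m hm).map_id (.mk a)
  map_mul f g := (Cat.FreeRefl.lift' (V := c.Ob) (D := d.Ob) φ m hm).map_comp f g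

lemma lift_atom {φ : O → O'} {c : CatOn O} {d : CatOn O'}
    (m : ∀ {a b : O}, c.Arr a b → d.Arr (φ a) (φ b))
    (hm : ∀ a : O, m (c.one a) = d.one (φ a)) {a b : O} (f : c.Arr a b) :
    (lift m hm).map (c.atom f) = m f :=
  Cat.FreeRefl.lift'_map (V := c.Ob) (D := d.Ob) φ m hm f

/-- Functors on `F U c` are determined by their values on generating arrows. -/
lemma Over.free_ext {φ : O → O'} {c : CatOn O} {d : CatOn O'} {F H : Over φ c.free d}
    (h : ∀ {a b : O} (f : c.Arr a b), F.map (c.atom f) = H.map (c.atom f)) : F = H := by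
  have key : ∀ (a b : O) (p : Quiver.Path (V := c.Ob) a b),
      F.map (a := a) (b := b) ((Cat.FreeRefl.quotientFunctor c.Ob).map p) =
        H.map ((Cat.FreeRefl.quotientFunctor c.Ob).map p) := by
    intro a b p
    induction p with
    | nil => exact (F.map_one a).trans (H.map_one a).symm
    | cons p q ih =>
      rename_i x y
      have hF := F.map_mul (x := a) (y := x) (z := y)
        ((Cat.FreeRefl.quotientFunctor c.Ob).map p) (c.atom q)
      have hH := H.map_mul (x := a) (y := x) (z := y)
        ((Cat.FreeRefl.quotientFunctor c.Ob).map p) (c.atom q)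
      exact hF.trans ((congrArg₂ d.mul ih (h q)).trans hH.symm)
  ext a b f
  obtain ⟨p, hp⟩ := (Cat.FreeRefl.quotientFunctor c.Ob).map_surjective
    (X := show Paths c.Ob from a) (Y := show Paths c.Ob from b) f
  rw [← hp]
  exact key a b p

/-- The functor `F U c ⥤ F U d` induced by a functor `c ⥤ d`. -/
def freeMap {φ : O → O'} {c : CatOn O} {d : CatOn O'} (F : Over φ c d) :
    Over φ c.free d.free :=
  lift (fun f => d.atom (F.map f)) fun a => by rw [F.map_one, atom_one]

lemma freeMap_atom {φ : O → O'} {c : CatOn O} {d : CatOn O'} (F : Over φ c d)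
    {a b : O} (f : c.Arr a b) : (freeMap F).map (c.atom f) = d.atom (F.map f) :=
  lift_atom _ _ f

/-- The counit `F U c ⥤ c`, which composes strings of arrows. -/
def counit (c : CatOn O) : c.free ⟶ c :=
  lift (fun f => f) fun _ => rfl

lemma counit_atom (c : CatOn O) {a b : O} (f : c.Arr a b) : Over.map c.counit (c.atom f) = f :=
  lift_atom _ _ f

/-- The comultiplication `F U c ⥤ F U F U c`, which puts parentheses around each individual arrow
of a string. -/
def comult (c : CatOn O) : c.free ⟶ c.free.free :=
  lift (fun f => c.free.atom (c.atom f)) fun a => by rw [atom_one, atom_one]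

lemma comult_atom (c : CatOn O) {a b : O} (f : c.Arr a b) :
    Over.map c.comult (c.atom f) = c.free.atom (c.atom f) :=
  lift_atom _ _ f

lemma freeMap_comp {φ : O → O'} {ψ : O' → O''} {c : CatOn O} {d : CatOn O'} {e : CatOn O''}
    (F : Over φ c d) (H : Over ψ d e) :
    freeMap (F.comp H) = (freeMap F).comp (freeMap H) :=
  Over.free_ext fun f => by simp only [Over.comp, freeMap_atom]

lemma freeMap_counit {φ : O → O'} {c : CatOn O} {d : CatOn O'} (F : Over φ c d) :
    (freeMap F).comp d.counit = Over.comp c.counit F :=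
  Over.free_ext fun f => by simp only [Over.comp, freeMap_atom, counit_atom]

lemma freeMap_comult {φ : O → O'} {c : CatOn O} {d : CatOn O'} (F : Over φ c d) :
    (freeMap F).comp d.comult = Over.comp c.comult (freeMap (freeMap F)) :=
  Over.free_ext fun f => by simp only [Over.comp, freeMap_atom, comult_atom]

/-- The comonad `F U` on categories with set of objects `O`. -/
def FU (O : Type u) : Comonad (CatOn O) where
  obj c := c.free
  map F := freeMap F
  map_id c := Over.free_ext fun f => freeMap_atom (𝟙 c : c ⟶ c) f
  map_comp F H := freeMap_comp F H
  ε := { app := fun c => c.counit, naturality := fun _ _ F => freeMap_counit F }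
  δ := { app := fun c => c.comult, naturality := fun _ _ F => freeMap_comult F }
  coassoc c := Over.free_ext fun f => by
    change Over.map (freeMap c.comult) (Over.map c.comult (c.atom f)) =
      Over.map c.free.comult (Over.map c.comult (c.atom f))
    simp only [comult_atom, freeMap_atom]
  left_counit c := Over.free_ext fun f => by
    change Over.map c.free.counit (Over.map c.comult (c.atom f)) = c.atom f
    simp only [comult_atom, counit_atom]
  right_counit c := Over.free_ext fun f => by
    change Over.map (freeMap c.counit) (Over.map c.comult (c.atom f)) = c.atom f
    simp only [comult_atom, freeMap_atom, counit_atom]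

/-- The functor `(F U)ⁿ c ⥤ (F U)ⁿ d` induced by a functor `c ⥤ d`. -/
def iterMap {φ : O → O'} {c : CatOn O} {d : CatOn O'} (F : Over φ c d) :
    ∀ n : ℕ, Over φ (iter (FU O) n c) (iter (FU O') n d)
  | 0 => F
  | n + 1 => freeMap (iterMap F n)

lemma iterMap_id (c : CatOn O) : ∀ n : ℕ, iterMap (𝟙 c) n = 𝟙 (iter (FU O) n c)
  | 0 => rfl
  | n + 1 => by
    rw [iterMap, iterMap_id c n]
    exact (FU O).map_id _

lemma iterMap_comp {φ : O → O'} {ψ : O' → O''} {c : CatOn O} {d : CatOn O'} {e : CatOn O''}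
    (F : Over φ c d) (H : Over ψ d e) :
    ∀ n : ℕ, iterMap (F.comp H) n = (iterMap F n).comp (iterMap H n)
  | 0 => rfl
  | n + 1 => by
    rw [iterMap, iterMap_comp F H n]
    exact freeMap_comp _ _

lemma counit_square {φ : O → O'} {c x : CatOn O} {d y : CatOn O'} {P : Over (fun a => a) c x}
    {Q : Over φ x y} {R : Over φ c d} {S : Over (fun a => a) d y} (h : P.comp Q = R.comp S) :
    Over.comp (Over.comp c.counit P) Q = (freeMap R).comp (Over.comp d.counit S) := by
  change Over.comp c.counit (P.comp Q) = Over.comp ((freeMap R).comp d.counit) S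
  rw [h, freeMap_counit]
  rfl

lemma comult_square {φ : O → O'} {c x : CatOn O} {d y : CatOn O'}
    {P : Over (fun a => a) c.free x} {Q : Over φ x y} {R : Over φ c d}
    {S : Over (fun a => a) d.free y} (h : P.comp Q = (freeMap R).comp S) :
    Over.comp (Over.comp c.comult (freeMap P)) (freeMap Q) =
      (freeMap R).comp (Over.comp d.comult (freeMap S)) := by
  change Over.comp c.comult ((freeMap P).comp (freeMap Q)) =
    Over.comp ((freeMap R).comp d.comult) (freeMap S)
  rw [← freeMap_comp, h, freeMap_comp, freeMap_comult]
  rfl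

lemma act_iterMap {φ : O → O'} {c : CatOn O} {d : CatOn O'} (F : Over φ c d) :
    ∀ (m n : ℕ) (θ : Fin m →o Fin n),
      Over.comp (act (FU O) c m n θ) (iterMap F m) =
        (iterMap F n).comp (act (FU O') d m n θ)
  | 0, 0, θ => by
    obtain rfl : θ = OrderHom.id := Subsingleton.elim _ _
    rw [act_id, act_id]
    rfl
  | _ + 1, 0, θ => (θ 0).elim0
  | 0, n + 1, θ => by
    rw [act_zero_succ _ _ θ (empty n), act_zero_succ _ _ θ (empty n)]
    exact counit_square (act_iterMap F 0 n (empty n))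
  | m + 1, n + 1, θ => by
    by_cases h : θ 0 = 0
    · rw [act_succ_of_eq _ _ θ h, act_succ_of_eq _ _ θ h]
      exact comult_square (act_iterMap F m (n + 1) (tail θ))
    · rw [act_succ_of_ne _ _ θ h, act_succ_of_ne _ _ θ h]
      exact counit_square (act_iterMap F (m + 1) n (lower θ h))
termination_by m n => m + n

end CatOn

/-! ### The free resolution of a category, as a simplicial category -/

/-- A small category, as a category structure on its set of objects. -/
def catOn (A : Type u) [Category.{u} A] : CatOn A := ⟨inferInstance⟩

/-- A functor, as an element of `CatOn.Over`. -/
def overOf {A B : Type u} [Category.{u} A] [Category.{u} B] (F : A ⥤ B) :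
    CatOn.Over F.obj (catOn A) (catOn B) :=
  ⟨fun f => F.map f, fun a => F.map_id a, fun f g => F.map_comp f g⟩

/-- The category of `n`-arrows `(F U)ⁿ⁺¹ A` of the free resolution of `A`, for varying `n`: a
simplicial object in categories with the objects of `A` and identity-on-objects functors. -/
def arrows (A : Type u) [Category.{u} A] : SimplicialObject (CatOn A) :=
  resolution (CatOn.FU A) (catOn A)

/-- The mapping spaces of the free resolution of `A`: the `n`-simplices are the `n`-arrows. -/
def mapSpace (A : Type u) [Category.{u} A] (a b : A) : SSet.{u} where
  obj k := ((arrows A).obj k).Arr a b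
  map f := ↾fun x => CatOn.Over.map ((arrows A).map f) x
  map_id k := by
    ext x
    exact congrArg (fun F : (arrows A).obj k ⟶ (arrows A).obj k => CatOn.Over.map F x)
      ((arrows A).map_id k)
  map_comp {k _ l} f g := by
    ext x
    exact congrArg (fun F : (arrows A).obj k ⟶ (arrows A).obj l => CatOn.Over.map F x)
      ((arrows A).map_comp f g)

/-- The free resolution `ℭA` of a category `A`. It has the same objects as `A`. -/
structure FreeResolution (A : Type u) where
  as : A

namespace FreeResolution

section

variable (A : Type u) [Category.{u} A]

instance : EnrichedCategory SSet.{u} (FreeResolution A) where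
  Hom x y := mapSpace A x.as y.as
  id x :=
    { app := fun k => ↾fun _ => ((arrows A).obj k).one x.as
      naturality := fun _ _ f => by
        ext
        exact (CatOn.Over.map_one ((arrows A).map f) x.as).symm }
  comp x y z :=
    { app := fun k => ↾fun p => ((arrows A).obj k).mul p.1 p.2
      naturality := fun _ _ f => by
        ext p
        exact (CatOn.Over.map_mul ((arrows A).map f) p.1 p.2).symm }
  id_comp x y := by
    ext k p
    exact Category.id_comp (obj := ((arrows A).obj k).Ob) p
  comp_id x y := by
    ext k p
    exact Category.comp_id (obj := ((arrows A).obj k).Ob) p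
  assoc x y z t := by
    ext k p
    exact Category.assoc (obj := ((arrows A).obj k).Ob) p.1 p.2.1 p.2.2

end

variable {A B C : Type u} [Category.{u} A] [Category.{u} B] [Category.{u} C]

/-- The simplicial functor `ℭA ⥤ ℭB` induced by a functor `A ⥤ B`. -/
def map (F : A ⥤ B) : EnrichedFunctor SSet.{u} (FreeResolution A) (FreeResolution B) where
  obj x := ⟨F.obj x.as⟩
  map x y :=
    { app := fun k => ↾fun f => (CatOn.iterMap (overOf F) (k.unop.len + 1)).map f
      naturality := fun k l θ => by
        ext f
        exact congrArg (fun H : CatOn.Over F.obj ((arrows A).obj k) ((arrows B).obj l) => H.map f)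
          (CatOn.act_iterMap (overOf F) _ _ θ.unop.toOrderHom) }
  map_id x := by
    ext k p
    exact (CatOn.iterMap (overOf F) (k.unop.len + 1)).map_one x.as
  map_comp x y z := by
    ext k p
    exact (CatOn.iterMap (overOf F) (k.unop.len + 1)).map_mul p.1 p.2

lemma map_id (A : Type u) [Category.{u} A] : map (𝟭 A) = EnrichedFunctor.id _ _ := by
  refine EnrichedFunctor.ext _ (fun _ => rfl) fun x y => ?_
  ext k f
  exact congrArg (fun H : CatOn.Over (fun a => a) ((arrows A).obj k) ((arrows A).obj k) => H.map f)
    (CatOn.iterMap_id (catOn A) (k.unop.len + 1))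

lemma map_comp (F : A ⥤ B) (H : B ⥤ C) : map (F ⋙ H) = (map F).comp _ (map H) := by
  refine EnrichedFunctor.ext _ (fun _ => rfl) fun x y => ?_
  ext k f
  exact congrArg (fun K : CatOn.Over (F ⋙ H).obj ((arrows A).obj k) ((arrows C).obj k) => K.map f)
    (CatOn.iterMap_comp (overOf F) (overOf H) (k.unop.len + 1))

end FreeResolution

/-! ### Homotopy coherent diagrams and the homotopy coherent nerve -/

/-- The ordinal category `[n]`, with a set of objects in the universe `u`. -/
abbrev OrdCat (n : ℕ) : Type u := ULift.{u} (Fin (n + 1))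

/-- The functor `[m] ⥤ [n]` given by a monotone map. -/
def ordMap {k l : SimplexCategory} (f : k ⟶ l) : OrdCat.{u} k.len ⥤ OrdCat.{u} l.len :=
  f.toOrderHom.uliftMap.monotone.functor

/-- An `n`-simplex of the nerve of `A`, as a functor `[n] ⥤ A`. -/
def simplexFunctor {A : Type u} [Category.{u} A] {n : ℕ} (x : ComposableArrows A n) :
    OrdCat.{u} n ⥤ A :=
  (show Monotone (ULift.down : OrdCat.{u} n → Fin (n + 1)) from fun _ _ h => h).functor ⋙ x

section

variable (A : Type u) [Category.{u} A] (S : Type w) [EnrichedCategory SSet.{u} S]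

/-- A homotopy coherent diagram of shape `A` in the simplicial category `S`: a simplicial functor
`ℭA ⥤ S`. -/
abbrev CohDiagram : Type (max u w) := EnrichedFunctor SSet.{u} (FreeResolution A) S

/-- The homotopy coherent nerve `𝔑S`: the `n`-simplices are the homotopy coherent diagrams of shape
`[n]` in `S`. -/
def cohNerve : SSet.{max u w} where
  obj k := CohDiagram (OrdCat.{u} k.unop.len) S
  map f := ↾fun X => (FreeResolution.map (ordMap.{u} f.unop)).comp _ X
  map_id k := by
    ext X
    change (FreeResolution.map (𝟭 _)).comp _ X = X
    rw [FreeResolution.map_id]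
    rfl
  map_comp f g := by
    ext X
    change (FreeResolution.map (ordMap.{u} g.unop ⋙ ordMap.{u} f.unop)).comp _ X = _
    rw [FreeResolution.map_comp]
    rfl

/-- The simplicial set `Coh(A, S)`: the `n`-simplices are the homotopy coherent diagrams of shape
`A × [n]` in `S`. -/
def Coh : SSet.{max u w} where
  obj k := CohDiagram (A × OrdCat.{u} k.unop.len) S
  map f := ↾fun X => (FreeResolution.map ((𝟭 A).prod (ordMap.{u} f.unop))).comp _ X
  map_id k := by
    ext X
    change (FreeResolution.map (𝟭 _)).comp _ X = X
    rw [FreeResolution.map_id]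
    rfl
  map_comp f g := by
    ext X
    change (FreeResolution.map
      ((𝟭 A).prod (ordMap.{u} g.unop) ⋙ (𝟭 A).prod (ordMap.{u} f.unop))).comp _ X = _
    rw [FreeResolution.map_comp]
    rfl

/-- The nerve of `A`, regarded as a simplicial set in the universe of `𝔑S`. -/
abbrev bigNerve : SSet.{max u w} := SSet.uliftFunctor.{w, u}.obj (nerve A)

end

/-- The map of nerves induced by a functor. -/
abbrev bigNerveMap {A B : Type u} [Category.{u} A] [Category.{u} B] (F : A ⥤ B) :
    bigNerve.{u, w} A ⟶ bigNerve.{u, w} B :=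
  SSet.uliftFunctor.{w, u}.map (nerveMap F)

/-- The map of homotopy coherent nerves induced by a simplicial functor. -/
def cohNerveMap {S T : Type w} [EnrichedCategory SSet.{u} S] [EnrichedCategory SSet.{u} T]
    (H : EnrichedFunctor SSet.{u} S T) : cohNerve.{u} S ⟶ cohNerve.{u} T where
  app _ := ↾fun X => X.comp _ H

end HCoh

open HCoh

/-! Everything rests on one fact: each `(F U)ⁿ A` is glued from the categories `(F U)ⁿ [k]` along
the functors `[k] ⥤ A`. Every arrow `a ⟶ b` is the image of an arrow `0 ⟶ k` of some `(F U)ⁿ [k]`,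
and two such representations (`Lift`) of one arrow are connected by a zigzag of restrictions along
functors `[k] ⥤ [l]` that preserve the end points (`Lift.Step`). This is `Cls.bijective`, proved by
induction on `n`. For `n = 0` every representation reduces to one over `[1]`. For `n + 1`,
representations are concatenated by joining simplices end to end. By freeness, an arrow of `(F U)ⁿ⁺¹
A` acts on classes of representations: a generating arrow acts by concatenation with its class of
representations, which is unique by induction. Acting on the class of the identity gives the inverse
of evaluation.

Applied in every simplicial degree, this shows that a compatible family of diagrams `ℭ[k] ⥤ S`,
indexed by the simplices of `N A`, glues to a unique diagram `ℭA ⥤ S` (`exists_diagram`,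
`diagram_ext`). Such a family is exactly a simplicial map `N A ⟶ 𝔑S`, and naturality is
functoriality of `ℭ`.

For the second part, `N (A × [k])` is `N A × Δ[k]`, so the first part identifies the `k`-simplices
of `Coh(A, S)` with maps `N A × Δ[k] ⟶ 𝔑S`, the `k`-simplices of the internal hom. The
identification is induced by the evaluation `cohEval`, whose transpose is therefore an isomorphism.
-/

namespace HCoh

/-! ### Joining simplices end to end -/

/-- The inclusion of the initial segment `[k]` of `[k + l]`. -/
def inl (k l : ℕ) : OrdCat.{u} k ⥤ OrdCat.{u} (k + l) :=
  Monotone.functor (f := fun i => ⟨Fin.castLE (by lia) i.down⟩) fun _ _ h => h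

/-- The inclusion of the final segment `[l]` of `[k + l]`. -/
def inr (k l : ℕ) : OrdCat.{u} l ⥤ OrdCat.{u} (k + l) :=
  Monotone.functor (f := fun i => ⟨Fin.natAdd k i.down⟩) fun _ _ h =>
    Nat.add_le_add_left (show _ ≤ _ from h) k

/-- The first object of `[k]`. -/
abbrev bot (k : ℕ) : OrdCat.{u} k := ⟨0⟩

/-- The last object of `[k]`. -/
abbrev top (k : ℕ) : OrdCat.{u} k := ⟨Fin.last k⟩

/-- Functors between ordinal categories are determined by their values on objects. -/
lemma ord_ext {k l : ℕ} {θ ψ : OrdCat.{u} k ⥤ OrdCat.{u} l} (h : ∀ i, θ.obj i = ψ.obj i) :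
    θ = ψ :=
  CategoryTheory.Functor.ext h fun _ _ _ => Subsingleton.elim _ _

section

variable {A : Type u} [Category.{u} A]

/-- Functors out of `[k]` are determined by their values on arrows `i ⟶ i + 1`. -/
lemma simplex_ext {k : ℕ} {x y : OrdCat.{u} k ⥤ A} (h : ∀ i, x.obj i = y.obj i)
    (w : ∀ (i : ℕ) (hi : i < k),
      x.map (homOfLE (show (⟨⟨i, by lia⟩⟩ : OrdCat.{u} k) ≤ ⟨⟨i + 1, by lia⟩⟩ from
        Nat.le_succ i)) ≍
      y.map (homOfLE (show (⟨⟨i, by lia⟩⟩ : OrdCat.{u} k) ≤ ⟨⟨i + 1, by lia⟩⟩ from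
        Nat.le_succ i))) : x = y := by
  let up : Fin (k + 1) ⥤ OrdCat.{u} k :=
    (show Monotone (ULift.up : Fin (k + 1) → OrdCat.{u} k) from fun _ _ h => h).functor
  have key : up ⋙ x = up ⋙ y :=
    ComposableArrows.ext (fun i => h ⟨i⟩) fun i hi =>
      (conj_eqToHom_iff_heq _ _ (h _) (h ⟨⟨i + 1, by lia⟩⟩)).2 (w i hi)
  exact congrArg
    (fun z => (show Monotone (ULift.down : OrdCat.{u} k → Fin (k + 1)) from
      fun _ _ h => h).functor ⋙ z) key

/-- Every object and every arrow `i ⟶ i + 1` of `[k + l]` lies in one of the two segments, and these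
data determine the functor. -/
lemma join_ext {k l : ℕ} {z z' : OrdCat.{u} (k + l) ⥤ A} (h : inl k l ⋙ z = inl k l ⋙ z')
    (h' : inr k l ⋙ z = inr k l ⋙ z') : z = z' := by
  have hl : ∀ (i : ℕ) (hi : i < k + 1), z.obj ⟨⟨i, by lia⟩⟩ = z'.obj ⟨⟨i, by lia⟩⟩ :=
    fun i hi => Functor.congr_obj h ⟨⟨i, hi⟩⟩
  have hr : ∀ (i : ℕ) (hi : i < l + 1), z.obj ⟨⟨k + i, by lia⟩⟩ = z'.obj ⟨⟨k + i, by lia⟩⟩ :=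
    fun i hi => Functor.congr_obj h' ⟨⟨i, hi⟩⟩
  refine simplex_ext ?_ ?_
  · rintro ⟨i, hi⟩
    by_cases hk : i < k + 1
    · exact hl i hk
    · obtain ⟨j, rfl⟩ := Nat.exists_eq_add_of_le (show k ≤ i by lia)
      exact hr j (by lia)
  · intro i hi
    by_cases hk : i < k
    · exact Functor.hcongr_hom h (X := ⟨⟨i, by lia⟩⟩) (Y := ⟨⟨i + 1, by lia⟩⟩)
        (homOfLE (show i ≤ i + 1 from Nat.le_succ i))
    · obtain ⟨j, rfl⟩ := Nat.exists_eq_add_of_le (show k ≤ i by lia)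
      exact Functor.hcongr_hom h' (X := ⟨⟨j, by lia⟩⟩) (Y := ⟨⟨j + 1, by lia⟩⟩)
        (homOfLE (show j ≤ j + 1 from Nat.le_succ j))

/-- A functor out of `[k + l]` may be prescribed freely on the arrows `i ⟶ i + 1`; each of these
belongs to exactly one of the two segments. -/
lemma exists_join {k l : ℕ} (x : OrdCat.{u} k ⥤ A) (y : OrdCat.{u} l ⥤ A)
    (h : x.obj (top k) = y.obj (bot l)) :
    ∃ z : OrdCat.{u} (k + l) ⥤ A, inl k l ⋙ z = x ∧ inr k l ⋙ z = y := by
  let obj : Fin (k + l + 1) → A := fun i =>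
    if hi : i.1 ≤ k then x.obj ⟨⟨i.1, by lia⟩⟩ else y.obj ⟨⟨i.1 - k, by lia⟩⟩
  have hl : ∀ (i : ℕ) (hi : i < k + 1), obj ⟨i, by lia⟩ = x.obj ⟨⟨i, hi⟩⟩ := fun i hi =>
    dif_pos (by dsimp; lia)
  -- The shared vertex `k` takes its value from `x`, so the case `i = 0` is the one that needs `h`.
  have hr : ∀ (i : ℕ) (hi : i < l + 1), obj ⟨k + i, by lia⟩ = y.obj ⟨⟨i, hi⟩⟩ := fun i hi => by
    rcases Nat.eq_zero_or_pos i with rfl | h0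
    · exact (hl k (by lia)).trans h
    · refine (dif_neg (by dsimp; lia)).trans ?_
      congr 3
      dsimp; lia
  have hm : ∀ i : Fin (k + l), ∃ f : obj i.castSucc ⟶ obj i.succ,
      (∀ hi : i.1 < k, f ≍ x.map (homOfLE (show (⟨⟨i, by lia⟩⟩ : OrdCat.{u} k) ≤
        ⟨⟨i + 1, by lia⟩⟩ from Nat.le_succ i))) ∧
      (∀ (j : ℕ) (hj : j < l), i.1 = k + j → f ≍ y.map (homOfLE (show (⟨⟨j, by lia⟩⟩ :
        OrdCat.{u} l) ≤ ⟨⟨j + 1, by lia⟩⟩ from Nat.le_succ j))) := by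
    rintro ⟨i, hi⟩
    by_cases hk : i < k
    · refine ⟨eqToHom (hl i (by lia)) ≫ x.map (homOfLE (show (⟨⟨i, by lia⟩⟩ : OrdCat.{u} k) ≤
        ⟨⟨i + 1, by lia⟩⟩ from Nat.le_succ i)) ≫ eqToHom (hl (i + 1) (by lia)).symm, ?_, ?_⟩
      · intro _
        simp
      · intro j hj e
        dsimp at e
        lia
    · obtain ⟨j, rfl⟩ := Nat.exists_eq_add_of_le (show k ≤ i by lia)
      refine ⟨eqToHom (hr j (by lia)) ≫ y.map (homOfLE (show (⟨⟨j, by lia⟩⟩ : OrdCat.{u} l) ≤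
        ⟨⟨j + 1, by lia⟩⟩ from Nat.le_succ j)) ≫ eqToHom (hr (j + 1) (by lia)).symm, ?_, ?_⟩
      · intro e
        dsimp at e
        lia
      · intro j' hj e
        obtain rfl : j = j' := by dsimp at e; lia
        simp
  choose f hf hf' using hm
  let w : ComposableArrows A (k + l) := ComposableArrows.mkOfObjOfMapSucc obj f
  have hw : ∀ (i : ℕ) (hi : i < k + l), w.map' i (i + 1) = f ⟨i, hi⟩ := fun i hi =>
    ComposableArrows.mkOfObjOfMapSucc_map_succ obj f i hi
  refine ⟨(show Monotone (ULift.down : OrdCat.{u} (k + l) → Fin (k + l + 1)) from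
      fun _ _ h => h).functor ⋙ w, simplex_ext (fun i => hl i.down.1 i.down.2) ?_,
      simplex_ext (fun i => hr i.down.1 i.down.2) ?_⟩
  · intro i hi
    exact (heq_of_eq (hw i (by lia))).trans (hf ⟨i, by lia⟩ hi)
  · intro i hi
    exact (heq_of_eq (hw (k + i) (by lia))).trans (hf' ⟨k + i, by lia⟩ i hi rfl)

/-- The functor on `[k + l]` that restricts to `x` on `[k]` and to `y` on `[l]`. -/
noncomputable def join {k l : ℕ} (x : OrdCat.{u} k ⥤ A) (y : OrdCat.{u} l ⥤ A)
    (h : x.obj (top k) = y.obj (bot l)) : OrdCat.{u} (k + l) ⥤ A :=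
  (exists_join x y h).choose

section

variable {k l : ℕ} (x : OrdCat.{u} k ⥤ A) (y : OrdCat.{u} l ⥤ A)
    (h : x.obj (top k) = y.obj (bot l))

lemma inl_join : inl k l ⋙ join x y h = x := (exists_join x y h).choose_spec.1

lemma inr_join : inr k l ⋙ join x y h = y := (exists_join x y h).choose_spec.2

lemma join_bot : (join x y h).obj (bot (k + l)) = x.obj (bot k) :=
  Functor.congr_obj (inl_join x y h) (bot k)

lemma join_top : (join x y h).obj (top (k + l)) = y.obj (top l) :=
  Functor.congr_obj (inr_join x y h) (top l)

variable {B : Type u} [Category.{u} B] (F : A ⥤ B)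

lemma join_comp : join x y h ⋙ F = join (x ⋙ F) (y ⋙ F) (congrArg F.obj h) :=
  join_ext (by rw [inl_join, ← Functor.assoc, inl_join])
    (by rw [inr_join, ← Functor.assoc, inr_join])

end

end

/-! ### Transport of arrows and induction in free categories -/

namespace CatOn

variable {O O' : Type u}

/-- Transport of an arrow along equalities of objects. -/
def recast (c : CatOn O) {a b a' b' : O} (ha : a = a') (hb : b = b') (f : c.Arr a b) :
    c.Arr a' b' :=
  cast (by rw [ha, hb]) f

variable (c : CatOn O)

lemma recast_recast {a b a' b' a'' b'' : O} (ha : a = a') (hb : b = b') (ha' : a' = a'')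
    (hb' : b' = b'') (f : c.Arr a b) :
    c.recast ha' hb' (c.recast ha hb f) = c.recast (ha.trans ha') (hb.trans hb') f := by
  subst ha hb ha' hb'; rfl

lemma Over.map_recast {c : CatOn O} {d : CatOn O'} {φ : O → O'} (F : Over φ c d) {a b a' b' : O}
    (ha : a = a') (hb : b = b') (f : c.Arr a b) :
    F.map (c.recast ha hb f) = d.recast (congrArg φ ha) (congrArg φ hb) (F.map f) := by
  subst ha hb; rfl

/-- Arrows of a free category are built up from identities by composing with generating arrows. -/
lemma free_induction {c : CatOn O} {a : O} {motive : ∀ b : O, c.free.Arr a b → Prop}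
    (one : motive a (c.free.one a))
    (mul : ∀ {b d : O} (p : c.free.Arr a b) (f : c.Arr b d), motive b p →
      motive d (c.free.mul p (c.atom f))) {b : O} (p : c.free.Arr a b) : motive b p := by
  have key : ∀ (b : O) (q : Quiver.Path (V := c.Ob) a b),
      motive b ((Cat.FreeRefl.quotientFunctor c.Ob).map q) := by
    intro b q
    induction q with
    | nil => exact one
    | cons q f ih => exact mul (b := _) (d := _) ((Cat.FreeRefl.quotientFunctor c.Ob).map q) f ih
  obtain ⟨q, hq⟩ := (Cat.FreeRefl.quotientFunctor c.Ob).map_surjective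
    (X := show Paths c.Ob from a) (Y := show Paths c.Ob from b) p
  rw [← hq]
  exact key b q

end CatOn

open CatOn

/-! ### Functoriality and generators of the iterates -/

section

variable {A B C : Type u} [Category.{u} A] [Category.{u} B] [Category.{u} C]

variable (A) in
/-- The category `(F U)ⁿ A`. -/
abbrev lev (n : ℕ) : CatOn A := iter (FU A) n (catOn A)

/-- The functor `(F U)ⁿ A ⥤ (F U)ⁿ B` induced by a functor `A ⥤ B`. -/
abbrev push (F : A ⥤ B) (n : ℕ) : Over F.obj (lev A n) (lev B n) := iterMap (overOf F) n

lemma push_id {n : ℕ} {a b : A} (f : (lev A n).Arr a b) : (push (𝟭 A) n).map f = f :=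
  congrArg (fun H : Over (fun a => a) (lev A n) (lev A n) => H.map f) (iterMap_id (catOn A) n)

lemma push_comp (F : A ⥤ B) (H : B ⥤ C) {n : ℕ} {a b : A} (f : (lev A n).Arr a b) :
    (push (F ⋙ H) n).map f = (push H n).map ((push F n).map f) :=
  congrArg (fun K : Over (F ⋙ H).obj (lev A n) (lev C n) => K.map f)
    (iterMap_comp (overOf F) (overOf H) n)

lemma push_congr {F F' : A ⥤ B} (h : F = F') {n : ℕ} {a b : A} (f : (lev A n).Arr a b) :
    (push F' n).map f =
      (lev B n).recast (Functor.congr_obj h a) (Functor.congr_obj h b) ((push F n).map f) := by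
  subst h; rfl

lemma push_push_congr {F : A ⥤ B} {H : B ⥤ C} {K : A ⥤ C} (h : K = F ⋙ H) {n : ℕ} {a b : A}
    (f : (lev A n).Arr a b) :
    (push H n).map ((push F n).map f) =
      (lev C n).recast (Functor.congr_obj h a) (Functor.congr_obj h b) ((push K n).map f) := by
  rw [← push_comp, push_congr h]

/-- The generating arrow of `(F U)ⁿ⁺¹ A` given by an arrow of `(F U)ⁿ A`. -/
def gen {n : ℕ} {a b : A} (f : (lev A n).Arr a b) : (lev A (n + 1)).Arr a b := (lev A n).atom f

lemma gen_one (n : ℕ) (a : A) : gen ((lev A n).one a) = (lev A (n + 1)).one a := atom_one _ a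

lemma push_gen (F : A ⥤ B) {n : ℕ} {a b : A} (f : (lev A n).Arr a b) :
    (push F (n + 1)).map (gen f) = gen ((push F n).map f) :=
  freeMap_atom _ f

/-- The composite of an arrow of `(F U)ⁿ⁺¹ [k]` and a generating arrow of `(F U)ⁿ⁺¹ [l]`, in
`(F U)ⁿ⁺¹ [k + l]`. -/
def wedge {n k l : ℕ} (g : (lev (OrdCat.{u} k) (n + 1)).Arr (bot k) (top k))
    (h : (lev (OrdCat.{u} l) n).Arr (bot l) (top l)) :
    (lev (OrdCat.{u} (k + l)) (n + 1)).Arr (bot (k + l)) (top (k + l)) :=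
  (lev _ (n + 1)).mul (y := (inl k l).obj (top k)) ((push (inl k l) (n + 1)).map g)
    (gen ((push (inr k l) n).map h))

/-- The functor induced by `z` preserves composites and generating arrows. The restrictions and end
points of `z` are variables, so that the equations can be eliminated by substitution; all later
comparisons of concatenations reduce to this form. -/
lemma recast_push_wedge {n k l : ℕ} {x : OrdCat.{u} k ⥤ A} {y : OrdCat.{u} l ⥤ A}
    {z : OrdCat.{u} (k + l) ⥤ A} (hx : inl k l ⋙ z = x) (hy : inr k l ⋙ z = y) {a b c : A}
    (ha : z.obj (bot _) = a) (hc : z.obj (top _) = c) (hxa : x.obj (bot k) = a)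
    (hxb : x.obj (top k) = b) (hyb : y.obj (bot l) = b) (hyc : y.obj (top l) = c)
    (g : (lev (OrdCat.{u} k) (n + 1)).Arr (bot k) (top k))
    (h : (lev (OrdCat.{u} l) n).Arr (bot l) (top l)) :
    (lev A (n + 1)).recast ha hc ((push z (n + 1)).map (wedge g h)) =
      (lev A (n + 1)).mul ((lev A (n + 1)).recast hxa hxb ((push x (n + 1)).map g))
        (gen ((lev A n).recast hyb hyc ((push y n).map h))) := by
  subst hx hy hxb ha hc
  refine ((push z (n + 1)).map_mul (y := (inl k l).obj (top k)) _ _).trans ?_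
  exact congrArg₂ ((lev A (n + 1)).mul (y := (inl k l ⋙ z).obj (top k))) (push_comp _ _ _).symm
    ((push_gen _ _).trans (congrArg gen (push_comp _ _ _).symm))

end

/-! ### Representations of arrows by simplices -/

/-- A representation of an arrow of `(F U)ⁿ A` as the image of an arrow `0 ⟶ k` of `(F U)ⁿ [k]`
under a functor `[k] ⥤ A`. -/
structure Lift (A : Type u) [Category.{u} A] (n : ℕ) (a b : A) where
  k : ℕ
  x : OrdCat.{u} k ⥤ A
  left : x.obj (bot k) = a
  right : x.obj (top k) = b
  g : (lev (OrdCat.{u} k) n).Arr (bot k) (top k)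

namespace Lift

variable {A B : Type u} [Category.{u} A] [Category.{u} B] {n : ℕ} {a b c : A}

/-- The represented arrow. -/
def val (L : Lift A n a b) : (lev A n).Arr a b :=
  (lev A n).recast L.left L.right ((push L.x n).map L.g)

/-- The image of a representation under a functor. -/
abbrev along (L : Lift A n a b) (F : A ⥤ B) : Lift B n (F.obj a) (F.obj b) :=
  ⟨L.k, L.x ⋙ F, congrArg F.obj L.left, congrArg F.obj L.right, L.g⟩

lemma ext_of_simplex {k : ℕ} {x x' : OrdCat.{u} k ⥤ A} (h : x = x')
    {g g' : (lev (OrdCat.{u} k) n).Arr (bot k) (top k)} (h' : g = g') {ha hb ha' hb'} :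
    (⟨k, x, ha, hb, g⟩ : Lift A n a b) = ⟨k, x', ha', hb', g'⟩ := by
  subst h h'; rfl

/-- Restriction of representations along a functor `[k] ⥤ [l]` that preserves the end points. -/
def Step (L M : Lift A n a b) : Prop :=
  ∃ (θ : OrdCat.{u} L.k ⥤ OrdCat.{u} M.k) (hb : θ.obj (bot _) = bot _)
    (ht : θ.obj (top _) = top _),
    L.x = θ ⋙ M.x ∧ M.g = (lev _ n).recast hb ht ((push θ n).map L.g)

/-- By functoriality, pushing along `θ` and then along `M.x` is pushing along `L.x`. Hence
evaluation descends to classes. -/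
lemma Step.val_eq {L M : Lift A n a b} (h : Step L M) : L.val = M.val := by
  obtain ⟨θ, hb, ht, hx, hg⟩ := h
  rw [val, val, hg, Over.map_recast, recast_recast, push_push_congr hx, recast_recast]

/-- The representation of an identity arrow by a functor `[0] ⥤ A`. -/
def one (n : ℕ) (a : A) : Lift A n a a :=
  ⟨0, (Functor.const _).obj a, rfl, rfl, (lev _ n).one (bot 0)⟩

lemma val_one : (one n a).val = (lev A n).one a := Over.map_one _ _

lemma along_one (F : A ⥤ B) : (one n a).along F = one n (F.obj a) :=
  ext_of_simplex (k := 0) (x := (Functor.const _).obj a ⋙ F)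
    (x' := (Functor.const _).obj (F.obj a))
    (simplex_ext (fun _ => rfl) fun i hi => absurd hi (Nat.not_lt_zero i)) rfl

/-- The concatenation of a representation of an arrow `p` of `(F U)ⁿ⁺¹ A` with a representation of
an arrow `f` of `(F U)ⁿ A` represents the composite of `p` and the generating arrow `f`. -/
noncomputable def comp (L : Lift A (n + 1) a b) (M : Lift A n b c) : Lift A (n + 1) a c :=
  ⟨L.k + M.k, join L.x M.x (L.right.trans M.left.symm), (join_bot ..).trans L.left,
    (join_top ..).trans M.right, wedge L.g M.g⟩

lemma val_comp (L : Lift A (n + 1) a b) (M : Lift A n b c) :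
    (L.comp M).val = (lev A (n + 1)).mul L.val (gen M.val) := by
  exact recast_push_wedge (inl_join _ _ (L.right.trans M.left.symm)) (inr_join ..) _ _ L.left
    L.right M.left M.right L.g M.g

/-- The step is `θ` on the initial segment and the identity on the final one; the two pieces fit
because `θ` preserves the last object. -/
lemma Step.comp_left {L L' : Lift A (n + 1) a b} (h : Step L L') (M : Lift A n b c) :
    Step (L.comp M) (L'.comp M) := by
  obtain ⟨θ, hb, ht, hx, hg⟩ := h
  have e : (θ ⋙ inl L'.k M.k).obj (top L.k) = (inr L'.k M.k).obj (bot M.k) :=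
    congrArg (inl L'.k M.k).obj ht
  have h₁ : inl L.k M.k ⋙ join (θ ⋙ inl L'.k M.k) (inr L'.k M.k) e = θ ⋙ inl L'.k M.k :=
    inl_join ..
  have h₂ : inr L.k M.k ⋙ join (θ ⋙ inl L'.k M.k) (inr L'.k M.k) e = inr L'.k M.k :=
    inr_join ..
  refine ⟨join (θ ⋙ inl L'.k M.k) (inr L'.k M.k) e,
    (join_bot ..).trans (congrArg (inl L'.k M.k).obj hb), join_top .., join_ext ?_ ?_, ?_⟩
  · exact (inl_join L.x M.x (L.right.trans M.left.symm)).trans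
      (hx.trans ((congrArg (θ ⋙ ·) (inl_join ..).symm).trans
      (congrArg (· ⋙ join L'.x M.x _) h₁.symm)))
  · exact (inr_join L.x M.x (L.right.trans M.left.symm)).trans ((inr_join ..).symm.trans
      (congrArg (· ⋙ join L'.x M.x _) h₂.symm))
  · refine Eq.trans ?_ (recast_push_wedge h₁ h₂ _ _ (congrArg (inl L'.k M.k).obj hb)
      e rfl rfl L.g M.g).symm
    refine congrArg₂ ((lev _ (n + 1)).mul (y := (inr L'.k M.k).obj (bot M.k))) ?_ rfl
    exact (congrArg (push (inl.{u} L'.k M.k) (n + 1)).map hg).trans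
      ((Over.map_recast ..).trans (congrArg _ (push_comp ..).symm))

/-- Here the pieces are the identity and `θ`, which fit because `θ` preserves the first object. -/
lemma Step.comp_right (L : Lift A (n + 1) a b) {M M' : Lift A n b c} (h : Step M M') :
    Step (L.comp M) (L.comp M') := by
  obtain ⟨θ, hb, ht, hx, hg⟩ := h
  have e : (inl L.k M'.k).obj (top L.k) = (θ ⋙ inr L.k M'.k).obj (bot M.k) :=
    (congrArg (inr L.k M'.k).obj hb).symm
  have h₁ : inl L.k M.k ⋙ join (inl L.k M'.k) (θ ⋙ inr L.k M'.k) e = inl L.k M'.k :=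
    inl_join ..
  have h₂ : inr L.k M.k ⋙ join (inl L.k M'.k) (θ ⋙ inr L.k M'.k) e = θ ⋙ inr L.k M'.k :=
    inr_join ..
  refine ⟨join (inl L.k M'.k) (θ ⋙ inr L.k M'.k) e, join_bot ..,
    (join_top ..).trans (congrArg (inr L.k M'.k).obj ht), join_ext ?_ ?_, ?_⟩
  · exact (inl_join L.x M.x (L.right.trans M.left.symm)).trans ((inl_join ..).symm.trans
      (congrArg (· ⋙ join L.x M'.x _) h₁.symm))
  · exact (inr_join L.x M.x (L.right.trans M.left.symm)).trans
      (hx.trans ((congrArg (θ ⋙ ·) (inr_join ..).symm).trans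
      (congrArg (· ⋙ join L.x M'.x _) h₂.symm)))
  · refine Eq.trans ?_ (recast_push_wedge h₁ h₂ _ _ rfl rfl e.symm
      (congrArg (inr L.k M'.k).obj ht) L.g M.g).symm
    refine congrArg₂ ((lev _ (n + 1)).mul (y := (inl L.k M'.k).obj (top L.k))) rfl
      (congrArg gen ?_)
    exact (congrArg (push (inr.{u} L.k M'.k) n).map hg).trans
      ((Over.map_recast ..).trans (congrArg _ (push_comp ..).symm))

/-- Since `[k + 0]` is `[k]` by definition, the identity functor is a step. The appended generator
is an identity, which the free category on a reflexive graph makes trivial (`gen_one`). -/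
lemma step_comp_one (L : Lift A (n + 1) a b) : Step (L.comp (one n b)) L := by
  refine ⟨𝟭 _, rfl, rfl, join_ext (inl_join L.x (one n b).x L.right)
    ((inr_join L.x (one n b).x L.right).trans ?_), ?_⟩
  · refine simplex_ext (fun i => ?_) fun i hi => absurd hi (Nat.not_lt_zero i)
    obtain rfl : i = top 0 := ULift.ext _ _ (Subsingleton.elim (α := Fin 1) _ _)
    exact L.right.symm
  · refine Eq.symm ((push_id _).trans ?_)
    have h₁ : (push (inr.{u} L.k 0) n).map (one n b).g = (lev _ n).one (top L.k) :=
      Over.map_one _ _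
    have h₂ : (push (inl.{u} L.k 0) (n + 1)).map L.g = L.g := push_id _
    refine (congrArg₂ (lev (OrdCat.{u} L.k) (n + 1)).mul h₂
      ((congrArg gen h₁).trans (gen_one _ _))).trans ?_
    exact Category.comp_id (obj := (lev (OrdCat.{u} L.k) (n + 1)).Ob) L.g

end Lift

/-! ### Classes of representations correspond to arrows -/

/-- Equivalence classes of representations of arrows of `(F U)ⁿ A`. -/
def Cls (A : Type u) [Category.{u} A] (n : ℕ) (a b : A) : Type u :=
  Quot (Lift.Step (n := n) (a := a) (b := b))

namespace Cls

variable {A B : Type u} [Category.{u} A] [Category.{u} B] {n : ℕ} {a b c : A}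

/-- The class of a representation. -/
abbrev mk (L : Lift A n a b) : Cls A n a b := Quot.mk _ L

/-- The represented arrow. -/
def val : Cls A n a b → (lev A n).Arr a b := Quot.lift Lift.val fun _ _ h => h.val_eq

/-- Concatenation of representations. -/
noncomputable def comp : Cls A (n + 1) a b → Cls A n b c → Cls A (n + 1) a c :=
  Quot.map₂ Lift.comp (fun L _ _ h => h.comp_right L) (fun _ _ M h => h.comp_left M)

/-- The category with the objects of `A` whose arrows `b ⟶ c` are the operations that turn
representations of arrows with target `b` into representations of arrows with target `c`. -/
def operations (A : Type u) [Category.{u} A] (n : ℕ) : CatOn A where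
  str :=
    { Hom := fun b c => ∀ a, Cls A (n + 1) a b → Cls A (n + 1) a c
      id := fun _ _ q => q
      comp := fun f g a q => g a (f a q) }

section

variable (H : ∀ a b : A, Function.Bijective (val (n := n) (a := a) (b := b)))

/-- The operation of `(F U)ⁿ⁺¹ A` on the classes of representations by composition with generating
arrows. -/
noncomputable def operate : Over (fun a => a) (lev A (n + 1)) (operations A n) :=
  lift (fun f _ q => q.comp ((Equiv.ofBijective _ (H _ _)).symm f)) fun b => by
    -- An identity generator has to act trivially. Its class contains the representation over `[0]`,
    -- for which `Lift.step_comp_one` applies.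
    have : (Equiv.ofBijective _ (H b b)).symm ((lev A n).one b) = mk (Lift.one n b) :=
      (Equiv.symm_apply_eq _).2 Lift.val_one.symm
    rw [this]
    funext a q
    obtain ⟨L⟩ := q
    exact Quot.sound L.step_comp_one

lemma operate_mul_atom {x y z : A} (p : (lev A (n + 1)).Arr x y) (M : Lift A n y z)
    (q : Cls A (n + 1) a x) :
    (operate H).map ((lev A (n + 1)).mul p (gen M.val)) a q =
      ((operate H).map p a q).comp (mk M) := by
  have e : (Equiv.ofBijective _ (H y z)).symm M.val = mk M :=
    (Equiv.symm_apply_eq _).2 rfl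
  refine (congrFun (congrFun ((operate H).map_mul p (gen M.val)) a) q).trans ?_
  have e' : (operate H).map (gen M.val) = fun _ q => q.comp (mk M) :=
    (lift_atom _ _ M.val).trans (by rw [e])
  exact congrFun (congrFun e' a) _

lemma surjective_succ (H : ∀ a b : A, Function.Bijective (val (n := n) (a := a) (b := b))) :
    Function.Surjective (val (A := A) (n := n + 1) (a := a) (b := b)) := by
  intro p
  refine free_induction (motive := fun b p => ∃ q : Cls A (n + 1) a b, q.val = p)
    ⟨mk (Lift.one _ a), Lift.val_one⟩ ?_ p
  rintro x y p f ⟨⟨L⟩, rfl⟩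
  obtain ⟨⟨M⟩, rfl⟩ := (H x y).2 f
  exact ⟨mk (L.comp M), L.val_comp M⟩

/-- The crux of injectivity. Decomposing `p` into generators inside `[k]` and concatenating their
representations there, then applying `x`, gives the same class as acting in `A`. The target `j` is
arbitrary so that induction on `p` is possible. -/
lemma operate_push (H' : ∀ {k : ℕ} (a b : OrdCat.{u} k),
    Function.Bijective (val (n := n) (a := a) (b := b)))
    {k : ℕ} (x : OrdCat.{u} k ⥤ A) {j : OrdCat.{u} k}
    (p : (lev _ (n + 1)).Arr (bot k) j) :
    ∃ L : Lift _ (n + 1) (bot k) j, L.val = p ∧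
      (operate H).map ((push x (n + 1)).map p) (x.obj (bot k)) (mk (Lift.one _ _)) =
        mk (L.along x) := by
  refine free_induction (motive := fun j p => ∃ L : Lift _ (n + 1) (bot k) j, L.val = p ∧
      (operate H).map ((push x (n + 1)).map p) (x.obj (bot k)) (mk (Lift.one _ _)) =
        mk (L.along x)) ⟨Lift.one _ _, Lift.val_one, ?_⟩ ?_ p
  · have e : (push x (n + 1)).map ((lev _ (n + 1)).one (bot k)) = (lev _ (n + 1)).one _ :=
      Over.map_one _ _
    refine (congrArg (fun f => (operate H).map f (x.obj (bot k)) (mk (Lift.one _ _))) e).trans ?_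
    exact (congrFun (congrFun ((operate H).map_one (x.obj (bot k))) (x.obj (bot k)))
      (mk (Lift.one (n + 1) (x.obj (bot k))))).trans (congrArg mk (Lift.along_one x).symm)
  · rintro i j p f ⟨L, hL, e⟩
    obtain ⟨⟨M⟩, rfl⟩ := (H' i j).2 f
    refine ⟨L.comp M, (L.val_comp M).trans (congrArg (fun q => (lev _ (n + 1)).mul q _) hL), ?_⟩
    have e₁ : (push x (n + 1)).map ((lev _ (n + 1)).mul p (gen M.val)) =
        (lev A (n + 1)).mul ((push x (n + 1)).map p) (gen (M.along x).val) := by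
      have e₂ : (push x n).map M.val = (M.along x).val := by
        rw [Lift.val, Lift.val, Over.map_recast, push_comp]
      rw [← e₂, ← push_gen]
      exact Over.map_mul _ _ _
    refine (congrArg (fun f => (operate H).map f (x.obj (bot k)) (mk (Lift.one _ _))) e₁).trans ?_
    rw [operate_mul_atom, e]
    exact congrArg mk (Lift.ext_of_simplex
      (join_comp L.x M.x (L.right.trans M.left.symm) x).symm rfl)

/-- The left inverse lets `p` act on the class of the identity. On `(k, x, g)` it returns the class
of `L.along x` for some representation `L` of `g` in `[k]`, and the simplex `L.x` is itself a step
from `L.along x` to `(k, x, g)`. -/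
lemma injective_succ (H : ∀ a b : A, Function.Bijective (val (n := n) (a := a) (b := b)))
    (H' : ∀ {k : ℕ} (a b : OrdCat.{u} k),
    Function.Bijective (val (n := n) (a := a) (b := b))) :
    Function.Injective (val (A := A) (n := n + 1) (a := a) (b := b)) := by
  refine Function.LeftInverse.injective
    (g := fun p => (show Cls A (n + 1) a b from (operate H).map p a (mk (Lift.one _ _)))) ?_
  rintro ⟨k, x, rfl, rfl, g⟩
  obtain ⟨L, hL, e⟩ := operate_push H H' x g
  refine e.trans (Quot.sound ⟨L.x, L.left, L.right, rfl, hL.symm⟩)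

end

/-- The arrow `0 ⟶ 1` of `[1]`. -/
def unitArrow : (lev (OrdCat.{u} 1) 0).Arr (bot 1) (top 1) :=
  (homOfLE (Fin.zero_le _) : bot 1 ⟶ top 1)

/-- The functor `[1] ⥤ A` given by an arrow of `A`. -/
def arrowFunctor (f : a ⟶ b) : OrdCat.{u} 1 ⥤ A :=
  simplexFunctor (ComposableArrows.mk₁ f)

/-- The arrow `g : 0 ⟶ k` is a functor `[1] ⥤ [k]` that preserves the end points, and it restricts
`x` to the arrow that `x` assigns to `g`. -/
lemma step_arrowFunctor {k : ℕ} (x : OrdCat.{u} k ⥤ A) (g : (lev _ 0).Arr (bot k) (top k)) :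
    Lift.Step (n := 0) ⟨1, arrowFunctor (x.map (show bot k ⟶ top k from g)), rfl, rfl, unitArrow⟩
      ⟨k, x, rfl, rfl, g⟩ := by
  refine ⟨arrowFunctor (show bot k ⟶ top k from g), rfl, rfl, ?_,
    Subsingleton.elim (α := bot k ⟶ top k) _ _⟩
  refine simplex_ext (fun i => ?_) fun i hi => ?_
  · obtain ⟨i⟩ := i
    fin_cases i <;> rfl
  · obtain rfl : i = 0 := by lia
    rfl

lemma bijective_zero : Function.Bijective (val (A := A) (n := 0) (a := a) (b := b)) := by
  refine ⟨?_, fun f => ⟨mk ⟨1, arrowFunctor f, rfl, rfl, unitArrow⟩, rfl⟩⟩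
  refine Function.LeftInverse.injective
    (g := fun f => mk ⟨1, arrowFunctor f, rfl, rfl, unitArrow⟩) ?_
  rintro ⟨k, x, rfl, rfl, g⟩
  exact Quot.sound (step_arrowFunctor x g)

/-- The induction is over all categories at once: the injectivity step uses the hypothesis for `A`
and for the ordinals. -/
theorem bijective : ∀ (n : ℕ) {A : Type u} [Category.{u} A] (a b : A),
    Function.Bijective (val (A := A) (n := n) (a := a) (b := b))
  | 0, _, _, _, _ => bijective_zero
  | n + 1, _, _, _, _ =>
    ⟨injective_succ (bijective n) fun a b => bijective n a b, surjective_succ (bijective n)⟩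

end Cls

/-! ### Defining functions on arrows through representations -/

section

variable {A : Type u} [Category.{u} A] {n : ℕ}

lemma exists_push_eq {a b : A} (f : (lev A n).Arr a b) :
    ∃ (k : ℕ) (x : OrdCat.{u} k ⥤ A) (ha : x.obj (bot k) = a) (hb : x.obj (top k) = b)
      (g : (lev _ n).Arr (bot k) (top k)), (lev A n).recast ha hb ((push x n).map g) = f := by
  obtain ⟨⟨k, x, ha, hb, g⟩, h⟩ := (Cls.bijective n a b).2 f
  exact ⟨k, x, ha, hb, g, h⟩

/-- Joining the two representing simplices places a composable pair in a single simplex, so that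
compatibility with composition can be checked there. -/
lemma exists_push_eq₂ {a b c : A} (f : (lev A n).Arr a b) (f' : (lev A n).Arr b c) :
    ∃ (k : ℕ) (x : OrdCat.{u} k ⥤ A) (i j l : OrdCat.{u} k) (ha : x.obj i = a)
      (hb : x.obj j = b) (hc : x.obj l = c) (g : (lev _ n).Arr i j) (g' : (lev _ n).Arr j l),
      (lev A n).recast ha hb ((push x n).map g) = f ∧
      (lev A n).recast hb hc ((push x n).map g') = f' := by
  obtain ⟨k, x, rfl, rfl, g, rfl⟩ := exists_push_eq f
  obtain ⟨l, y, hb, rfl, g', rfl⟩ := exists_push_eq f'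
  refine ⟨k + l, join x y hb.symm, (inl k l).obj (bot k), (inl k l).obj (top k),
    (inr k l).obj (top l), Functor.congr_obj (inl_join ..) _, Functor.congr_obj (inl_join ..) _,
    Functor.congr_obj (inr_join ..) _, (push (inl k l) n).map g, (push (inr k l) n).map g', ?_, ?_⟩
  · rw [push_push_congr (inl_join ..).symm, recast_recast]
  · exact (congrArg ((lev A n).recast _ _) (push_push_congr (inr_join ..).symm g')).trans
      (recast_recast ..)

/-- `(F U)ⁿ A` is the colimit of the `(F U)ⁿ [k]` over the functors `[k] ⥤ A`. -/
theorem exists_desc {T : A → A → Type w}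
    (Φ : ∀ {k : ℕ} (x : OrdCat.{u} k ⥤ A) {i j : OrdCat.{u} k}, (lev _ n).Arr i j →
      T (x.obj i) (x.obj j))
    (hΦ : ∀ {k l : ℕ} (θ : OrdCat.{u} k ⥤ OrdCat.{u} l) (x : OrdCat.{u} l ⥤ A)
      {i j : OrdCat.{u} k} (g : (lev _ n).Arr i j), Φ (θ ⋙ x) g = Φ x ((push θ n).map g)) :
    ∃ Ψ : ∀ {a b : A}, (lev A n).Arr a b → T a b,
      ∀ {k : ℕ} (x : OrdCat.{u} k ⥤ A) {i j : OrdCat.{u} k} (g : (lev _ n).Arr i j),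
        Ψ ((push x n).map g) = Φ x g := by
  let ev {a b : A} (L : Lift A n a b) : T a b := cast (by rw [L.left, L.right]) (Φ L.x L.g)
  have hev {a b : A} (L M : Lift A n a b) (h : L.Step M) : ev L = ev M := by
    obtain ⟨k, x, ha, hb, g⟩ := L
    obtain ⟨l, y, rfl, rfl, g'⟩ := M
    obtain ⟨θ, hθ, hθ', rfl, rfl⟩ : ∃ (θ : OrdCat.{u} k ⥤ OrdCat.{u} l)
      (hb : θ.obj (bot k) = bot l) (ht : θ.obj (top k) = top l),
      x = θ ⋙ y ∧ g' = (lev _ n).recast hb ht ((push θ n).map g) := h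
    have key : ∀ {i j i' j' : OrdCat.{u} l} (h : i = i') (h' : j = j') (f : (lev _ n).Arr i j)
        (e : T (y.obj i) (y.obj j) = T (y.obj i') (y.obj j')),
        cast e (Φ y f) = Φ y ((lev _ n).recast h h' f) := by
      rintro i j _ _ rfl rfl f e
      rfl
    refine Eq.trans ?_ (key hθ hθ' _ (by rw [hθ, hθ']))
    exact congrArg (cast _) (hΦ θ y g)
  refine ⟨fun {a b} f => Quot.lift ev hev ((Equiv.ofBijective _ (Cls.bijective n a b)).symm f),
    fun x i j g => ?_⟩
  -- The arrow `g` need not join the end points of `[k]`, so it is first represented inside `[k]` by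
  -- a simplex `θ` whose end points are `i` and `j`.
  obtain ⟨m, θ, rfl, rfl, g, rfl⟩ := exists_push_eq g
  have e : (Equiv.ofBijective _ (Cls.bijective n _ _)).symm ((push x n).map ((push θ n).map g)) =
      Cls.mk ⟨m, θ ⋙ x, rfl, rfl, g⟩ :=
    (Equiv.symm_apply_eq _).2 (push_comp θ x g).symm
  exact (congrArg (Quot.lift ev hev) e).trans (hΦ θ x g)

end

/-! ### Diagrams and maps of nerves -/

/-- An enriched functor whose values on objects are known up to propositional equality. -/
lemma exists_eq_mk {V : Type v} [Category.{u} V] [MonoidalCategory V] {C : Type*} {D : Type*}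
    [EnrichedCategory V C] [EnrichedCategory V D] (E : EnrichedFunctor V C D) (o : C → D)
    (h : ∀ c, E.obj c = o c) : ∃ m p q, E = ⟨o, m, p, q⟩ := by
  obtain rfl : E.obj = o := funext h
  exact ⟨E.map, E.map_id, E.map_comp, rfl⟩

section

variable {A : Type u} [Category.{u} A] {S : Type w} [EnrichedCategory SSet.{u} S]

/-- A compatible family of diagrams, indexed by the simplices of the nerve of `A`, is induced by a
diagram of shape `A`. -/
theorem exists_diagram (D : ∀ {k : ℕ}, (OrdCat.{u} k ⥤ A) → CohDiagram (OrdCat.{u} k) S)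
    (hD : ∀ {k l : ℕ} (θ : OrdCat.{u} k ⥤ OrdCat.{u} l) (x : OrdCat.{u} l ⥤ A),
      D (θ ⋙ x) = (FreeResolution.map θ).comp _ (D x)) :
    ∃ X : CohDiagram A S, ∀ {k : ℕ} (x : OrdCat.{u} k ⥤ A),
      (FreeResolution.map x).comp _ X = D x := by
  -- The value at an object is read off from the corresponding vertex.
  let o (a : A) : S := (D ((Functor.const (OrdCat.{u} 0)).obj a)).obj ⟨bot 0⟩
  have ho {k : ℕ} (x : OrdCat.{u} k ⥤ A) (i : FreeResolution (OrdCat.{u} k)) :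
      (D x).obj i = o (x.obj i.as) := by
    have e : (Functor.const (OrdCat.{u} 0)).obj (x.obj i.as) =
        (Functor.const (OrdCat.{u} 0)).obj i.as ⋙ x :=
      simplex_ext (fun _ => rfl) fun j hj => absurd hj (Nat.not_lt_zero j)
    dsimp only [o]
    rw [e, hD]
    rfl
  -- Each `D x` is rewritten so that its object function is literally `o` after `x`; mapping spaces
  -- for different simplices then agree without transport.
  choose m hid hcomp hm using fun (k : ℕ) (x : OrdCat.{u} k ⥤ A) =>
    exists_eq_mk (D x) (fun i => o (x.obj i.as)) (ho x)
  have hmθ {k l : ℕ} (θ : OrdCat.{u} k ⥤ OrdCat.{u} l) (x : OrdCat.{u} l ⥤ A)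
      (i j : FreeResolution (OrdCat.{u} k)) :
      m k (θ ⋙ x) i j = (FreeResolution.map θ).map i j ≫ m l x ⟨θ.obj i.as⟩ ⟨θ.obj j.as⟩ := by
    have e := hD θ x
    rw [hm, hm l x] at e
    exact congrFun (congrFun (eq_of_heq (EnrichedFunctor.mk.inj e).2) i) j
  -- The `n`-arrows form `(F U)ⁿ⁺¹ A`, hence the shift by one.
  choose Ψ hΨ using fun n : SimplexCategoryᵒᵖ =>
    exists_desc (A := A) (n := n.unop.len + 1)
      (T := fun a b => (o a ⟶[SSet.{u}] o b).obj n)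
      (fun {k} x {i j} g => (m k x ⟨i⟩ ⟨j⟩).app n g)
      (fun {k l} θ x {i j} g => by rw [hmθ]; rfl)
  refine ⟨⟨fun a => o a.as, fun a b => ⟨fun n => ↾fun f => Ψ n f, ?_⟩, ?_, ?_⟩, ?_⟩
  · intro n n' f
    ext g
    obtain ⟨a⟩ := a
    obtain ⟨b⟩ := b
    obtain ⟨k, x, rfl, rfl, g, rfl⟩ := exists_push_eq (n := n.unop.len + 1) (a := a) (b := b) g
    have e := congrArg (fun φ => φ g) ((FreeResolution.map x).map ⟨bot k⟩ ⟨top k⟩ |>.naturality f)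
    have e' := congrArg (fun φ => φ g) ((m k x ⟨bot k⟩ ⟨top k⟩).naturality f)
    exact (congrArg (Ψ n') e.symm).trans ((hΨ n' x _).trans (e'.trans
      (congrArg ((o _ ⟶[SSet.{u}] o _).map f) (hΨ n x g).symm)))
  · rintro ⟨a⟩
    ext n p
    let x : OrdCat.{u} 0 ⥤ A := (Functor.const _).obj a
    have e := congrArg (fun φ => φ.app n p) (hid 0 x ⟨bot 0⟩)
    exact (congrArg (Ψ n) (Over.map_one (push x _) (bot 0)).symm).trans ((hΨ n x _).trans e)
  · rintro ⟨a⟩ ⟨b⟩ ⟨c⟩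
    ext n ⟨g, g'⟩
    obtain ⟨k, x, i, j, l, rfl, rfl, rfl, g, g', rfl, rfl⟩ :=
      exists_push_eq₂ (n := n.unop.len + 1) (a := a) (b := b) (c := c) g g'
    have e := congrArg (fun φ => φ.app n (g, g')) (hcomp k x ⟨i⟩ ⟨j⟩ ⟨l⟩)
    refine (congrArg (Ψ n) (Over.map_mul (push x _) g g').symm).trans
      ((hΨ n x _).trans (e.trans ?_))
    exact congrArg ((eComp SSet.{u} (o _) (o _) (o _)).app n)
      (Prod.ext (hΨ n x g).symm (hΨ n x g').symm)
  · intro k x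
    rw [hm]
    refine EnrichedFunctor.ext _ (fun _ => rfl) fun i j => ?_
    ext n g
    exact hΨ n x g

/-- A diagram of shape `A` is determined by its restrictions to the simplices of the nerve
of `A`. -/
theorem diagram_ext {X Y : CohDiagram A S} (h : ∀ {k : ℕ} (x : OrdCat.{u} k ⥤ A),
    (FreeResolution.map x).comp _ X = (FreeResolution.map x).comp _ Y) : X = Y := by
  have ho : ∀ a, X.obj a = Y.obj a := fun a =>
    congrArg (fun Z => Z.obj ⟨bot 0⟩) (h ((Functor.const (OrdCat.{u} 0)).obj a.as))
  obtain ⟨m, p, q, rfl⟩ := exists_eq_mk X Y.obj ho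
  refine EnrichedFunctor.ext _ (fun _ => rfl) fun ⟨a⟩ ⟨b⟩ => ?_
  ext n g
  obtain ⟨k, x, rfl, rfl, g, rfl⟩ := exists_push_eq (n := n.unop.len + 1) (a := a) (b := b) g
  have e := congrFun (congrFun (eq_of_heq (EnrichedFunctor.mk.inj (h x)).2) ⟨bot k⟩) ⟨top k⟩
  exact congrArg (fun φ => φ.app n g) e

/-- A simplex of the nerve of `A`, from a functor `[n] ⥤ A`. -/
def toNerve {k : ℕ} (x : OrdCat.{u} k ⥤ A) : ComposableArrows A k :=
  (show Monotone (ULift.up : Fin (k + 1) → OrdCat.{u} k) from fun _ _ h => h).functor ⋙ x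

/-- Functors between ordinal categories are given by monotone maps. -/
lemma exists_ordMap_eq {k l : ℕ} (θ : OrdCat.{u} k ⥤ OrdCat.{u} l) :
    ∃ f : SimplexCategory.mk k ⟶ SimplexCategory.mk l, ordMap.{u} f = θ :=
  ⟨SimplexCategory.mkHom ⟨fun i => (θ.obj ⟨i⟩).down, fun _ _ h => θ.monotone h⟩,
    ord_ext fun _ => rfl⟩

/-- The map of simplicial sets corresponding to a diagram. -/
def nerveHom (X : CohDiagram A S) : bigNerve.{u, w} A ⟶ cohNerve.{u, w} S where
  app k := ↾fun x => (FreeResolution.map (simplexFunctor x.down)).comp _ X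
  naturality k l f := by
    ext x
    exact congrArg (fun Z => EnrichedFunctor.comp SSet.{u} Z X)
      (FreeResolution.map_comp (ordMap.{u} f.unop) (simplexFunctor x.down))

/-- Functors between ordinals are exactly monotone maps, so compatibility of a family of diagrams is
naturality of a map of simplicial sets. -/
lemma nerveHom_bijective :
    Function.Bijective (nerveHom : CohDiagram A S → (bigNerve.{u, w} A ⟶ cohNerve.{u, w} S)) := by
  refine ⟨fun X Y h => diagram_ext fun {k} x => ?_, fun Φ => ?_⟩
  · exact congrArg (fun f => f.app (op (SimplexCategory.mk k)) ⟨toNerve x⟩) h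
  · obtain ⟨X, hX⟩ := exists_diagram (A := A) (S := S)
      (fun {k} x => Φ.app (op (SimplexCategory.mk k)) ⟨toNerve x⟩) (fun {k l} θ x => by
        obtain ⟨f, rfl⟩ := exists_ordMap_eq θ
        exact congrArg (fun φ => φ ⟨toNerve x⟩) (Φ.naturality f.op))
    refine ⟨X, ?_⟩
    ext k x
    exact hX (simplexFunctor x.down)

end

/-! ### The internal hom -/

section

variable (A : Type u) [Category.{u} A] (S : Type w) [EnrichedCategory SSet.{u} S]

/-- The evaluation map `N A × Coh(A, S) ⟶ 𝔑 S`. -/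
def cohEval : bigNerve.{u, w} A ⊗ Coh.{u, w} A S ⟶ cohNerve.{u, w} S where
  app k := ↾fun p => (FreeResolution.map ((simplexFunctor p.1.down).prod' (𝟭 _))).comp _ p.2
  naturality k l f := by
    ext p
    -- Both sides come from the functor `[l] ⥤ A × [k]` whose components are the restriction of `x`
    -- along `f`, and `f` itself.
    have e := (FreeResolution.map_comp (ordMap.{u} f.unop)
      ((simplexFunctor p.1.down).prod' (𝟭 (OrdCat.{u} k.unop.len)))).symm.trans
      (FreeResolution.map_comp
        ((simplexFunctor ((nerve A).map f p.1.down)).prod' (𝟭 (OrdCat.{u} l.unop.len)))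
        ((𝟭 A).prod (ordMap.{u} f.unop)))
    exact congrArg (fun Z => EnrichedFunctor.comp SSet.{u} Z p.2) e.symm

variable (k : SimplexCategory)

/-- The nerve of `A × [k]` is the product of the nerve of `A` and the standard `k`-simplex. -/
def nerveProd : bigNerve.{u, w} A ⊗ SSet.stdSimplex.{max u w}.obj k ⟶
    bigNerve.{u, w} (A × OrdCat.{u} k.len) where
  app _ := ↾fun p => ⟨toNerve ((simplexFunctor p.1.down).prod'
    (ordMap.{u} (SSet.stdSimplex.objEquiv p.2)))⟩
  naturality _ _ _ := rfl

lemma ordMap_injective {k l : SimplexCategory} {f g : k ⟶ l}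
    (h : ordMap.{u} f = ordMap.{u} g) : f = g := by
  ext i
  exact congrArg (fun j => (ULift.down j).1) (Functor.congr_obj h ⟨i⟩)

lemma nerveProd_app_bijective (l : SimplexCategoryᵒᵖ) :
    Function.Bijective ((nerveProd.{u, w} A k).app l) := by
  refine ⟨fun ⟨⟨x⟩, s⟩ ⟨⟨y⟩, t⟩ h => ?_, fun ⟨z⟩ => ?_⟩
  · have e : (simplexFunctor x).prod' (ordMap.{u} (SSet.stdSimplex.objEquiv s)) =
      (simplexFunctor y).prod' (ordMap.{u} (SSet.stdSimplex.objEquiv t)) :=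
      congrArg (fun z => simplexFunctor (ULift.down z)) h
    refine Prod.ext ?_ ?_
    · exact congrArg (fun z => ULift.up (toNerve (z ⋙ CategoryTheory.Prod.fst _ _))) e
    · exact SSet.stdSimplex.objEquiv.injective
        (ordMap_injective (congrArg (fun z => z ⋙ CategoryTheory.Prod.snd _ _) e))
  · obtain ⟨f, hf⟩ := exists_ordMap_eq (simplexFunctor z ⋙ CategoryTheory.Prod.snd _ _)
    refine ⟨(⟨toNerve (simplexFunctor z ⋙ CategoryTheory.Prod.fst _ _)⟩,
      SSet.stdSimplex.objEquiv.symm f), ?_⟩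
    exact congrArg (fun θ => ULift.up (toNerve
      ((simplexFunctor z ⋙ CategoryTheory.Prod.fst _ _).prod' θ))) hf

instance : IsIso (nerveProd.{u, w} A k) := by
  have (l : SimplexCategoryᵒᵖ) : IsIso ((nerveProd.{u, w} A k).app l) :=
    (isIso_iff_bijective _).2 (nerveProd_app_bijective A k l)
  exact NatIso.isIso_of_isIso_app _

variable {A S k}

/-- The pairing of `x` with the identity, followed by the product of the identity and `s`, is the
pairing of `x` and `s`. Thus evaluation at `X` is the map that the first part assigns to `X`. -/
lemma whiskerLeft_cohEval (X : (Coh.{u, w} A S).obj (op k)) :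
    bigNerve.{u, w} A ◁ SSet.yonedaEquiv.symm X ≫ cohEval A S =
      nerveProd.{u, w} A k ≫ nerveHom X := by
  ext l ⟨x, s⟩
  exact congrArg (fun Z => EnrichedFunctor.comp SSet.{u} Z X)
    (FreeResolution.map_comp ((simplexFunctor x.down).prod' (𝟭 _))
      ((𝟭 A).prod (ordMap.{u} (SSet.stdSimplex.objEquiv s)))).symm

lemma whiskerLeft_cohEval_bijective :
    Function.Bijective fun X : (Coh.{u, w} A S).obj (op k) =>
      bigNerve.{u, w} A ◁ SSet.yonedaEquiv.symm X ≫ cohEval A S := by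
  simp only [whiskerLeft_cohEval]
  exact (asIso (nerveProd.{u, w} A k)).symm.homFromEquiv.bijective.comp nerveHom_bijective

variable (A S)

/-- Bijectivity is checked on `k`-simplices. After the Yoneda and exponential bijections, the
transpose of `cohEval` becomes the map of `whiskerLeft_cohEval_bijective`. -/
instance : IsIso (MonoidalClosed.curry (cohEval.{u, w} A S)) := by
  have (k : SimplexCategoryᵒᵖ) : IsIso ((MonoidalClosed.curry (cohEval.{u, w} A S)).app k) := by
    refine (isIso_iff_bijective _).2 ?_
    have h := (((SSet.yonedaEquiv.{max u w} (n := k.unop)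
      (X := (ihom (bigNerve.{u, w} A)).obj (cohNerve.{u, w} S))).symm.trans
      ((ihom.adjunction (bigNerve.{u, w} A)).homEquiv _ _).symm)).bijective
    refine (Function.Bijective.of_comp_iff' h _).1 ?_
    have e : (fun X : (Coh.{u, w} A S).obj k =>
        bigNerve.{u, w} A ◁ (SSet.yonedaEquiv (n := k.unop)).symm X ≫ cohEval A S) =
        ((SSet.yonedaEquiv.{max u w} (n := k.unop)
          (X := (ihom (bigNerve.{u, w} A)).obj (cohNerve.{u, w} S))).symm.trans
          ((ihom.adjunction (bigNerve.{u, w} A)).homEquiv _ _).symm) ∘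
          (MonoidalClosed.curry (cohEval.{u, w} A S)).app k := by
      funext X
      refine Eq.trans ?_ (congrArg ((ihom.adjunction (bigNerve.{u, w} A)).homEquiv _ _).symm
        (SSet.yonedaEquiv_symm_comp (n := k.unop) X (MonoidalClosed.curry (cohEval.{u, w} A S))))
      rw [← MonoidalClosed.curry_natural_left]
      exact (MonoidalClosed.uncurry_curry _).symm
    rw [← e]
    exact whiskerLeft_cohEval_bijective (k := k.unop)
  exact NatIso.isIso_of_isIso_app _

end

end HCoh

theorem mainTheorem4 :
    ∃ φ : ∀ (A : Type u) [Category.{u} A] (S : Type w) [EnrichedCategory SSet.{u} S],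
        CohDiagram A S ≃ (bigNerve.{u, w} A ⟶ cohNerve.{u, w} S),
      (∀ (A : Type u) [Category.{u} A] (S : Type w) [EnrichedCategory SSet.{u} S]
          (X : CohDiagram A S) (k : SimplexCategory) (x : (nerve A).obj (op k)),
        (φ A S X).app (op k) ⟨x⟩ = (FreeResolution.map (simplexFunctor x)).comp _ X) ∧
      (∀ (A B : Type u) [Category.{u} A] [Category.{u} B] (S : Type w)
          [EnrichedCategory SSet.{u} S] (F : A ⥤ B) (X : CohDiagram B S),
        φ A S ((FreeResolution.map F).comp _ X) = bigNerveMap.{u, w} F ≫ φ B S X) ∧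
      (∀ (A : Type u) [Category.{u} A] (S T : Type w) [EnrichedCategory SSet.{u} S]
          [EnrichedCategory SSet.{u} T] (H : EnrichedFunctor SSet.{u} S T) (X : CohDiagram A S),
        φ A T (X.comp _ H) = φ A S X ≫ cohNerveMap H) ∧
      (∀ (A : Type u) [Category.{u} A] (S : Type w) [EnrichedCategory SSet.{u} S],
        ∃ ψ : Coh.{u, w} A S ≅ (ihom (bigNerve.{u, w} A)).obj (cohNerve.{u, w} S),
          ∀ (k : SimplexCategory) (x : (nerve A).obj (op k)) (X : (Coh.{u, w} A S).obj (op k)),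
            (MonoidalClosed.uncurry ψ.hom).app (op k) (⟨x⟩, X) =
              (FreeResolution.map ((simplexFunctor x).prod' (𝟭 _))).comp _ X) := by
  refine ⟨fun A _ S _ => Equiv.ofBijective nerveHom nerveHom_bijective, fun _ _ _ _ _ _ _ => rfl,
    fun A B _ _ S _ F X => ?_, fun _ _ _ _ _ _ _ _ => rfl, fun A _ S _ => ?_⟩
  · ext k x
    exact congrArg (fun Z => EnrichedFunctor.comp SSet.{u} Z X)
      (FreeResolution.map_comp (simplexFunctor x.down) F).symm
  · refine ⟨asIso (MonoidalClosed.curry (cohEval.{u, w} A S)), fun k x X => ?_⟩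
    rw [asIso_hom, MonoidalClosed.uncurry_curry]
    rfl
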